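/- Let $\varepsilon > 0$ be a real number. There is a real number $p_0(\varepsilon)$, depending only on $\varepsilon$, such that for every prime $p \equiv 1 \pmod 3$ with $p > p_0(\varepsilon)$, \[ \#\{\text{primes } q < p^{\frac12+\varepsilon} : q \text{ is a cubic residue mod } p\} > p^{\frac{1}{30}\varepsilon}. \] Here an integer $a$ is a cubic residue mod $p$ if $a$ is coprime to $p$ and $a \equiv x^3 \pmod p$ for some integer $x$. -/

import Mathlib

/-- The integer `a` is a cubic residue modulo `p`: it is prime to `p` and congruent
modulo `p` to the cube of an integer. -/
def IsCubicResidue (p : ℕ) (a : ℤ) : Prop :=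
  IsCoprime a (p : ℤ) ∧ ∃ x : ℤ, x ^ 3 ≡ a [ZMOD (p : ℤ)]

/-! Let `J = a + bω` be the Jacobi sum of a cubic character modulo `p`; its norm is `p`. Cubic
reciprocity, in the form `exists_cube_of_jacobiSum_eq_mul_cube`, makes a prime `q ≠ 3, p` a cube
modulo `p` as soon as `J` is, modulo `q`, a scalar times `(u + ω)³`. For `u = 3w + 2` this
proportionality is the vanishing modulo `q` of `cubicValue a b w`, a cubic polynomial in `w` with
coefficients `O(√p)`. So its prime divisors other than `p` are cubic residues, and for `w` up to a
small multiple of `p^(ε/3)` they are below `p^(1/2+ε)`.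

These values cannot be built from few primes. A prime power `q^k` divides at most `3(N/q^k + 1)` of
the first `N` values, so if all prime divisors lie in `T`, the logarithms of `N = 4d` values add up
to at most about `24 d log |T|`. A third difference shows that they add up to at least `3 d log d`.
Hence `|T|` is at least about `d^(1/8)`; with `d` of order `p^(ε/3)` this exceeds `p^(ε/30)`. -/

/-! ### Cubic characters and their Jacobi sums. -/

theorem exists_cubeRoot_pow_coeffs (n : ℕ) : ∃ α β : ℤ, ∀ (K : Type) [Field K] (ω : K),
    ω ^ 2 + ω + 1 = 0 → ω ^ n = α + β * ω := by
  induction n with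
  | zero => exact ⟨1, 0, fun K _ ω _ => by simp⟩
  | succ n ih =>
    obtain ⟨α, β, h⟩ := ih
    refine ⟨-β, α - β, fun K _ ω hω => ?_⟩
    rw [pow_succ, h K ω hω]
    push_cast
    linear_combination (β : K) * hω

theorem MulChar.apply_generator_pow {p : ℕ} {K : Type} [Field K] (χ : MulChar (ZMod p) K)
    (g : (ZMod p)ˣ) (n : ℕ) : χ ((g ^ n : (ZMod p)ˣ) : ZMod p) = χ g ^ n := by
  rw [Units.val_pow_eq_pow_val, map_pow]

theorem exists_eq_generator_pow {p : ℕ} [Fact p.Prime] {g : (ZMod p)ˣ}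
    (hg : ∀ x, x ∈ Subgroup.zpowers g) {x : ZMod p} (hx : x ≠ 0) :
    ∃ n : ℕ, x = ((g ^ n : (ZMod p)ˣ) : ZMod p) := by
  obtain ⟨n, hn⟩ := (mem_powers_iff_mem_zpowers (x := g) (y := Units.mk0 x hx)).2 (hg _)
  exact ⟨n, by simpa using (congrArg Units.val hn).symm⟩

/-- The coefficients of the cubic Jacobi sum are integers that do not depend on the field in which
the character takes its values. -/
theorem exists_jacobiSum_coeffs (p : ℕ) [Fact p.Prime] (g : (ZMod p)ˣ)
    (hg : ∀ x, x ∈ Subgroup.zpowers g) :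
    ∃ a b : ℤ, ∀ (K : Type) [Field K] (ω : K), ω ^ 2 + ω + 1 = 0 →
      ∀ χ : MulChar (ZMod p) K, χ g = ω → jacobiSum χ χ = a + b * ω := by
  have key : ∀ x : ZMod p, ∃ α β : ℤ, ∀ (K : Type) [Field K] (ω : K), ω ^ 2 + ω + 1 = 0 →
      ∀ χ : MulChar (ZMod p) K, χ g = ω → χ x * χ (1 - x) = α + β * ω := by
    intro x
    by_cases hx : x = 0
    · exact ⟨0, 0, fun K _ ω _ χ _ => by simp [hx, χ.map_zero]⟩
    by_cases hx' : 1 - x = 0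
    · exact ⟨0, 0, fun K _ ω _ χ _ => by simp [hx', χ.map_zero]⟩
    obtain ⟨i, hi⟩ := exists_eq_generator_pow hg hx
    obtain ⟨j, hj⟩ := exists_eq_generator_pow hg hx'
    obtain ⟨α, β, h⟩ := exists_cubeRoot_pow_coeffs (i + j)
    refine ⟨α, β, fun K _ ω hω χ hχ => ?_⟩
    rw [hj, hi, χ.apply_generator_pow, χ.apply_generator_pow, hχ, ← pow_add, h K ω hω]
  choose α β h using key
  refine ⟨∑ x, α x, ∑ x, β x, fun K _ ω hω χ hχ => ?_⟩
  rw [jacobiSum, Finset.sum_congr rfl fun x _ => h x K ω hω χ hχ, Finset.sum_add_distrib,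
    ← Finset.sum_mul]
  push_cast
  rfl

theorem exists_mulChar_generator {p : ℕ} [Fact p.Prime] (hp : p ≡ 1 [MOD 3]) {g : (ZMod p)ˣ}
    (hg : ∀ x, x ∈ Subgroup.zpowers g) {K : Type} [Field K] {ω : K} (hω : ω ^ 2 + ω + 1 = 0) :
    ∃ χ : MulChar (ZMod p) K, χ g = ω := by
  have hω3 : ω ^ 3 = 1 := by linear_combination (ω - 1) * hω
  have hω0 : ω ≠ 0 := by rintro rfl; simp at hω
  have hmem : Units.mk0 ω hω0 ∈ rootsOfUnity (Fintype.card (ZMod p)ˣ) K := by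
    rw [mem_rootsOfUnity, ZMod.card_units]
    have : p - 1 = 3 * ((p - 1) / 3) := by
      have := (Fact.out : p.Prime).two_le
      have : p % 3 = 1 := hp
      omega
    ext
    rw [this, pow_mul]
    simp [hω3]
  exact ⟨MulChar.ofRootOfUnity hmem hg, by rw [MulChar.ofRootOfUnity_spec]; rfl⟩

theorem MulChar.eq_of_generator {p : ℕ} [Fact p.Prime] {g : (ZMod p)ˣ}
    (hg : ∀ x, x ∈ Subgroup.zpowers g) {K : Type} [Field K] {χ χ' : MulChar (ZMod p) K}
    (h : χ g = χ' g) : χ = χ' := (MulChar.eq_iff hg χ χ').2 h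

/-- Over `ℂ`, the Jacobi sums of `χ` and `χ⁻¹` multiply to `p`, and passing to `χ⁻¹` replaces `ω` by
`ω²`. -/
theorem jacobiSum_coeffs_norm {p : ℕ} [Fact p.Prime] (hp : p ≡ 1 [MOD 3]) {g : (ZMod p)ˣ}
    (hg : ∀ x, x ∈ Subgroup.zpowers g) {a b : ℤ}
    (h : ∀ (K : Type) [Field K] (ω : K), ω ^ 2 + ω + 1 = 0 →
      ∀ χ : MulChar (ZMod p) K, χ g = ω → jacobiSum χ χ = a + b * ω) :
    a ^ 2 - a * b + b ^ 2 = p := by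
  obtain ⟨ω, hω⟩ : ∃ ω : ℂ, ω ^ 2 + ω + 1 = 0 := by
    obtain ⟨z, hz⟩ := IsAlgClosed.exists_pow_nat_eq (-3 : ℂ) (n := 2) (by norm_num)
    exact ⟨(-1 + z) / 2, by linear_combination hz / 4⟩
  have hω3 : ω ^ 3 = 1 := by linear_combination (ω - 1) * hω
  have hω1 : ω ≠ 1 := by rintro rfl; norm_num at hω
  have hω2 : ω ^ 2 ≠ 1 := fun h2 => hω1 (by linear_combination hω3 - ω * h2)
  obtain ⟨χ, hχ⟩ := exists_mulChar_generator hp hg hω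
  have hχinv : χ⁻¹ g = ω ^ 2 := by
    have : χ⁻¹ g * χ g = 1 := by rw [← MulChar.mul_apply]; simp
    rw [hχ] at this
    linear_combination ω ^ 2 * this - χ⁻¹ g * hω3
  have hχ1 : χ ≠ 1 := by rintro rfl; exact hω1 (by rw [← hχ]; simp)
  have hχ2 : χ * χ ≠ 1 := fun h1 => hω2 (by
    have := congrArg (fun f : MulChar (ZMod p) ℂ => f g) h1
    rwa [MulChar.mul_apply, hχ, ← sq, MulChar.one_apply_coe] at this)
  have hJ := jacobiSum_mul_jacobiSum_inv (F := ZMod p) (F' := ℂ)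
    (by rw [ringChar.eq_zero, ZMod.ringChar_zmod_n]; exact (Fact.out : p.Prime).ne_zero.symm)
    hχ1 hχ1 hχ2
  rw [h ℂ ω hω χ hχ, h ℂ (ω ^ 2) (by linear_combination hω + ω * hω3) χ⁻¹ hχinv, ZMod.card] at hJ
  have : ((a ^ 2 - a * b + b ^ 2 : ℤ) : ℂ) = ((p : ℤ) : ℂ) := by
    push_cast
    linear_combination hJ - (a : ℂ) * b * hω - (b : ℂ) ^ 2 * hω3
  exact_mod_cast this

/-! ### Cubic reciprocity through Gauss sums in characteristic `q`. -/

/-- If the cubic Jacobi sum `a + bω` is, over the prime field with `q` elements, a scalar multiple of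
the cube of `u + ω`, then `q` is a cube modulo `p`. -/
theorem exists_cube_of_jacobiSum_eq_mul_cube {p : ℕ} [Fact p.Prime] (hp : p ≡ 1 [MOD 3])
    {g : (ZMod p)ˣ} (hg : ∀ x, x ∈ Subgroup.zpowers g) {a b : ℤ}
    (h : ∀ (K : Type) [Field K] (ω : K), ω ^ 2 + ω + 1 = 0 →
      ∀ χ : MulChar (ZMod p) K, χ g = ω → jacobiSum χ χ = a + b * ω)
    {q : ℕ} [Fact q.Prime] (hq3 : q ≠ 3) (hqp : q ≠ p) (u : ℤ) (r : ZMod q)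
    (hA : (a : ZMod q) = r * (u ^ 3 - 3 * u + 1)) (hB : (b : ZMod q) = r * (3 * u ^ 2 - 3 * u)) :
    ∃ y : ZMod p, y ^ 3 = q := by
  have hab := jacobiSum_coeffs_norm hp hg h
  have hpP : p.Prime := Fact.out
  have hqP : q.Prime := Fact.out
  let K := AlgebraicClosure (ZMod q)
  have : CharP K q := charP_of_injective_algebraMap (algebraMap (ZMod q) K).injective q
  have hpK : (p : K) ≠ 0 := by
    rw [Ne, CharP.cast_eq_zero_iff K q]
    exact fun hd => hqp ((Nat.prime_dvd_prime_iff_eq hqP hpP).1 hd)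
  have h3K : (3 : K) ≠ 0 := by
    have : ((3 : ℕ) : K) ≠ 0 := by
      rw [Ne, CharP.cast_eq_zero_iff K q]
      exact fun hd => hq3 ((Nat.prime_dvd_prime_iff_eq hqP Nat.prime_three).1 hd)
    exact_mod_cast this
  have : NeZero (p : K) := ⟨hpK⟩
  obtain ⟨ω, hω⟩ : ∃ ω : K, ω ^ 2 + ω + 1 = 0 := by
    have : NeZero ((3 : ℕ) : K) := ⟨by exact_mod_cast h3K⟩
    obtain ⟨ω, hω⟩ := HasEnoughRootsOfUnity.exists_primitiveRoot K 3
    refine ⟨ω, ?_⟩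
    have := hω.geom_sum_eq_zero (by norm_num)
    simp only [Finset.sum_range_succ, Finset.sum_range_zero] at this
    linear_combination this
  have hω3 : ω ^ 3 = 1 := by linear_combination (ω - 1) * hω
  have hω1 : ω ≠ 1 := by
    rintro rfl
    exact h3K (by linear_combination hω)
  obtain ⟨χ, hχ⟩ := exists_mulChar_generator hp hg hω
  have hχ1 : χ ≠ 1 := by rintro rfl; exact hω1 (by rw [← hχ]; simp)
  have hχ3 : χ ^ 3 = 1 := MulChar.eq_of_generator hg (by
    rw [MulChar.pow_apply_coe, hχ, hω3]; simp)
  have hχ2 : χ * χ ≠ 1 := fun h1 => hχ1 (by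
    rw [← hχ3, pow_succ, sq, h1, one_mul])
  have hord : orderOf χ = 3 := orderOf_eq_prime hχ3 hχ1
  obtain ⟨ζ, hζ⟩ := HasEnoughRootsOfUnity.exists_primitiveRoot K p
  obtain ⟨ψ, hψ⟩ : ∃ ψ : AddChar (ZMod p) K, ψ.IsPrimitive :=
    ⟨_, AddChar.zmodChar_primitive_of_primitive_root p hζ⟩
  have hneg : χ (-1) = 1 := by
    have h1 : χ (-1) ^ 3 = 1 := by
      rw [← MulChar.pow_apply' _ (by norm_num), hχ3]
      exact MulChar.one_apply isUnit_one.neg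
    rw [← map_pow] at h1
    rwa [show ((-1 : ZMod p)) ^ 3 = -1 by ring] at h1
  set G := gaussSum χ ψ with hG
  set G' := gaussSum (χ * χ) ψ with hG'
  set c : K := u + ω with hc
  set c' : K := u + ω ^ 2 with hc'
  set ρ : K := algebraMap (ZMod q) K r with hρ
  have haK : (a : K) = ρ * (u ^ 3 - 3 * u + 1) := by
    have := congrArg (algebraMap (ZMod q) K) hA
    simpa [map_ofNat, hρ] using this
  have hbK : (b : K) = ρ * (3 * u ^ 2 - 3 * u) := by
    have := congrArg (algebraMap (ZMod q) K) hB
    simpa [map_ofNat, hρ] using this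
  have hJ : jacobiSum χ χ = ρ * c ^ 3 := by
    rw [h K ω hω χ hχ, haK, hbK, hc]
    linear_combination (-3 * ρ * u) * hω - ρ * hω3
  have hJ' : (a : K) + b * ω ^ 2 = ρ * c' ^ 3 := by
    rw [haK, hbK, hc']
    linear_combination (-3 * ρ * u) * hω - ρ * (ω ^ 3 + 1 + 3 * u * ω) * hω3
  have hpJ : (p : K) = (ρ * c ^ 3) * (ρ * c' ^ 3) := by
    rw [← hJ, ← hJ', h K ω hω χ hχ]
    have : ((a ^ 2 - a * b + b ^ 2 : ℤ) : K) = ((p : ℤ) : K) := by rw [hab]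
    push_cast at this
    linear_combination -this + (-(a : K) * b) * hω - (b : K) ^ 2 * hω3
  have hρ0 : ρ ≠ 0 := by intro h0; rw [h0] at hpJ; simp at hpJ; exact hpK hpJ
  have hc0 : c ≠ 0 := by intro h0; rw [h0] at hpJ; simp at hpJ; exact hpK hpJ
  have hc0' : c' ≠ 0 := by intro h0; rw [h0] at hpJ; simp at hpJ; exact hpK hpJ
  -- `G³ = pJ` with `J = ρc³` and `p = ρ²c³c'³`, so `G` is known up to a cube root of unity `z`.
  have hG3 : G ^ 3 = (ρ * c ^ 2 * c') ^ 3 := by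
    have := gaussSum_pow_eq_prod_jacobiSum (χ := χ) (by rw [hord]; norm_num) hψ
    rw [hord, hneg, ZMod.card] at this
    simp only [Nat.reduceSub, Nat.Ico_succ_singleton, Finset.prod_singleton, pow_one] at this
    rw [hG, this, hJ, hpJ]
    ring
  have hGG : G' * (ρ * c ^ 3) = G ^ 2 := by
    rw [← hJ, sq]; exact jacobiSum_mul_nontrivial hχ2 ψ
  obtain ⟨z, hz3, hz⟩ : ∃ z : K, z ^ 3 = 1 ∧ G = z * (ρ * c ^ 2 * c') := by
    have hne : ρ * c ^ 2 * c' ≠ 0 := mul_ne_zero (mul_ne_zero hρ0 (pow_ne_zero 2 hc0)) hc0'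
    refine ⟨G / (ρ * c ^ 2 * c'), ?_, (div_mul_cancel₀ _ hne).symm⟩
    rw [div_pow, hG3, div_self (pow_ne_zero _ hne)]
  have hz' : G' = z ^ 2 * (ρ * c * c' ^ 2) := by
    have hne : ρ * c ^ 3 ≠ 0 := mul_ne_zero hρ0 (pow_ne_zero _ hc0)
    apply mul_right_cancel₀ hne
    rw [hGG, hz]; ring
  have hGne : G ≠ 0 := by
    intro h0
    rw [h0] at hG3
    exact pow_ne_zero 3 (mul_ne_zero (mul_ne_zero hρ0 (pow_ne_zero 2 hc0)) hc0') (by simpa using hG3.symm)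
  have hG'ne : G' ≠ 0 := by
    intro h0; rw [h0, zero_mul] at hGG; exact pow_ne_zero 2 hGne hGG.symm
  have hfρ : ρ ^ q = ρ := by rw [hρ, ← map_pow, ZMod.pow_card]
  have hfu : (u : K) ^ q = u := by
    have : (u : K) = algebraMap (ZMod q) K u := by simp
    rw [this, ← map_pow, ZMod.pow_card]
  have hqU : IsUnit (q : ZMod p) := by
    rw [isUnit_iff_ne_zero, Ne, ZMod.natCast_eq_zero_iff]
    exact fun hd => hqp ((Nat.prime_dvd_prime_iff_eq hpP hqP).1 hd).symm
  have hmod : q % 3 = 1 ∨ q % 3 = 2 := by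
    have : ¬ 3 ∣ q := fun hd => hq3 ((Nat.prime_dvd_prime_iff_eq Nat.prime_three hqP).1 hd).symm
    omega
  have hpow : ∀ x : K, x ^ 3 = 1 → x ^ q = x ^ (q % 3) := fun x hx => pow_eq_pow_mod q hx
  have hcq : c ^ q = u + ω ^ q := by rw [hc, add_pow_char, hfu]
  have hcq' : c' ^ q = u + (ω ^ q) ^ 2 := by
    rw [hc', add_pow_char, hfu, ← pow_mul, ← pow_mul, mul_comm]
  -- The `q`-th power computed on the Gauss sum itself; below it is compared with the `q`-th power
  -- of the explicit form of `G`.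
  have hfrob : (χ ^ q) q * G ^ q = gaussSum (χ ^ q) ψ := by
    rw [hG, gaussSum_frob, AddChar.pow_mulShift]
    have := gaussSum_mulShift (χ ^ q) ψ hqU.unit
    rwa [hqU.unit_spec] at this
  have hχq : χ ^ q = χ ^ (q % 3) := pow_eq_pow_mod q hχ3
  have hval : χ q = 1 := by
    rcases hmod with hm | hm
    · have hωq : ω ^ q = ω := by rw [hpow ω hω3, hm, pow_one]
      have hGq : G ^ q = G := by
        rw [hz, mul_pow, mul_pow, mul_pow, ← pow_mul, mul_comm 2 q, pow_mul, hpow z hz3, hm, pow_one,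
          hfρ, hcq, hcq', hωq]
      rw [hχq, hm, pow_one, hGq] at hfrob
      exact mul_right_cancel₀ hGne (by rw [hfrob, one_mul])
    · have hωq : ω ^ q = ω ^ 2 := by rw [hpow ω hω3, hm]
      have hω4 : (ω ^ 2) ^ 2 = ω := by linear_combination ω * hω3
      -- For `q ≡ 2 (mod 3)` Frobenius exchanges `c` and `c'` and squares `z`.
      have hGq : G ^ q = G' := by
        rw [hz, mul_pow, mul_pow, mul_pow, ← pow_mul, mul_comm 2 q, pow_mul, hpow z hz3, hm,
          hfρ, hcq, hcq', hωq, hω4, hz', hc, hc']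
        ring
      rw [hχq, hm, hGq, sq χ] at hfrob
      have h2 : (χ * χ) q = 1 := mul_right_cancel₀ hG'ne (by rw [hfrob, one_mul])
      rw [MulChar.mul_apply] at h2
      have h3 : (χ ^ 3) q = 1 := by rw [hχ3]; exact MulChar.one_apply hqU
      rw [MulChar.pow_apply' _ (by norm_num)] at h3
      linear_combination h3 - χ q * h2
  obtain ⟨n, hn⟩ := exists_eq_generator_pow hg hqU.ne_zero
  rw [hn, χ.apply_generator_pow, hχ] at hval
  have h3n : 3 ∣ n := by
    have : orderOf ω = 3 := orderOf_eq_prime hω3 hω1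
    rw [← this]; exact orderOf_dvd_of_pow_eq_one hval
  obtain ⟨m, rfl⟩ := h3n
  exact ⟨((g ^ m : (ZMod p)ˣ) : ZMod p), by rw [hn]; push_cast; ring⟩

/-! ### The cubic polynomial and its prime divisors. -/

/-- One third of the determinant of `a + bω` and `(3w + 2 + ω)³` with respect to the basis `1, ω`,
where `ω` is a primitive cube root of unity. -/
def cubicValue (a b w : ℤ) : ℤ := b * (9 * w * (w + 1) ^ 2 + 1) - a * (9 * w * (w + 1) + 2)

theorem not_dvd_right_of_norm_eq_prime {p : ℕ} (hp : p.Prime) {a b : ℤ}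
    (hab : a ^ 2 - a * b + b ^ 2 = p) : ¬ (p : ℤ) ∣ b := by
  intro hb
  have hpZ : Prime (p : ℤ) := Nat.prime_iff_prime_int.1 hp
  have ha : (p : ℤ) ∣ a := by
    apply hpZ.dvd_of_dvd_pow (n := 2)
    have : a ^ 2 = p + b * (a - b) := by linear_combination hab
    rw [this]
    exact dvd_add dvd_rfl (hb.mul_right _)
  obtain ⟨x, rfl⟩ := ha
  obtain ⟨y, rfl⟩ := hb
  have h1 : (p : ℤ) * (x ^ 2 - x * y + y ^ 2) = 1 :=
    mul_left_cancel₀ hpZ.ne_zero (by linear_combination hab)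
  exact hpZ.not_isUnit (IsUnit.of_mul_eq_one _ h1)

/-- Modulo 3 the value is `a + b`, whose square is `p`. The choice `u = 3w + 2` serves to remove the
prime 3. -/
theorem not_three_dvd_cubicValue {p : ℕ} (hp : p ≡ 1 [MOD 3]) {a b : ℤ}
    (hab : a ^ 2 - a * b + b ^ 2 = p) (w : ℤ) : ¬ (3 : ℤ) ∣ cubicValue a b w := by
  intro h
  have h1 : (3 : ℤ) ∣ a + b := by
    have : a + b = cubicValue a b w
        - 3 * (b * (3 * w * (w + 1) ^ 2) - a * (3 * w * (w + 1)) - a) := by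
      unfold cubicValue; ring
    rw [this]
    exact dvd_sub h (dvd_mul_right _ _)
  have h2 : (3 : ℤ) ∣ p := by
    have : (p : ℤ) = (a + b) * (a + b) - 3 * (a * b) := by rw [← hab]; ring
    rw [this]
    exact dvd_sub (h1.mul_right _) (dvd_mul_right _ _)
  have h3 : 3 ∣ p := by exact_mod_cast h2
  have : p % 3 = 1 := hp
  omega

/-- Modulo `p`, `ω ↦ -a/b` is a ring map killing `a + bω`, so the determinant becomes a multiple of
the cube of `u - a/b`: a triple root. -/
theorem dvd_linear_of_dvd_cubicValue {p : ℕ} (hp : p.Prime) {a b : ℤ}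
    (hab : a ^ 2 - a * b + b ^ 2 = p) {w : ℤ} (h : (p : ℤ) ∣ cubicValue a b w) :
    (p : ℤ) ∣ b * (3 * w + 2) - a := by
  apply (Nat.prime_iff_prime_int.1 hp).dvd_of_dvd_pow (n := 3)
  have : (b * (3 * w + 2) - a) ^ 3 = 3 * b ^ 2 * cubicValue a b w
      + p * (3 * (b * (3 * w + 2) - a) - (b - 2 * a)) := by
    rw [← hab]; unfold cubicValue; ring
  rw [this]
  exact dvd_add (h.mul_left _) (dvd_mul_right _ _)

theorem not_sq_dvd_cubicValue {p : ℕ} (hp : p.Prime) (hp3 : p ≠ 3) {a b : ℤ}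
    (hab : a ^ 2 - a * b + b ^ 2 = p) (w : ℤ) : ¬ (p : ℤ) ^ 2 ∣ cubicValue a b w := by
  intro h
  have hpZ : Prime (p : ℤ) := Nat.prime_iff_prime_int.1 hp
  obtain ⟨y, hy⟩ := dvd_linear_of_dvd_cubicValue hp hab ((dvd_pow_self _ two_ne_zero).trans h)
  obtain ⟨z, hz⟩ := h
  have h1 : b - 2 * a = p * (3 * b ^ 2 * z - p * y ^ 3 + 3 * y) := by
    apply mul_left_cancel₀ hpZ.ne_zero
    have : (b * (3 * w + 2) - a) ^ 3 = 3 * b ^ 2 * cubicValue a b w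
        + p * (3 * (b * (3 * w + 2) - a) - (b - 2 * a)) := by
      rw [← hab]; unfold cubicValue; ring
    rw [hy, hz] at this
    linear_combination this
  have h2 : (p : ℤ) ∣ 3 * b ^ 2 := by
    have : 3 * b ^ 2 = p * 4 - (b - 2 * a) * (b - 2 * a) := by rw [← hab]; ring
    rw [this, h1, mul_assoc]
    exact dvd_sub (dvd_mul_right _ _) (dvd_mul_right _ _)
  rcases hpZ.dvd_or_dvd h2 with h3 | h3
  · have : p ∣ 3 := by exact_mod_cast h3
    exact hp3 ((Nat.prime_dvd_prime_iff_eq hp Nat.prime_three).1 this)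
  · exact not_dvd_right_of_norm_eq_prime hp hab (hpZ.dvd_of_dvd_pow h3)

theorem cubicValue_ne_zero {p : ℕ} (hp : p.Prime) (hp3 : p ≠ 3) {a b : ℤ}
    (hab : a ^ 2 - a * b + b ^ 2 = p) (w : ℤ) : cubicValue a b w ≠ 0 := fun h =>
  not_sq_dvd_cubicValue hp hp3 hab w (h ▸ dvd_zero _)

theorem not_dvd_norm_of_dvd_cubicValue {p q : ℕ} (hp : p.Prime) (hq : q.Prime) (hqp : q ≠ p)
    {a b : ℤ} (hab : a ^ 2 - a * b + b ^ 2 = p) {w : ℤ} (h : (q : ℤ) ∣ cubicValue a b w) :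
    ¬ (q : ℤ) ∣ 3 * w ^ 2 + 3 * w + 1 := by
  intro hn
  have he : (q : ℤ) ∣ a - b * (3 * w + 2) := by
    have : a - b * (3 * w + 2) = cubicValue a b w
        - (3 * w ^ 2 + 3 * w + 1) * (3 * b * (w + 1) - 3 * a) := by unfold cubicValue; ring
    rw [this]
    exact dvd_sub h (hn.mul_right _)
  have hqp' : (q : ℤ) ∣ p := by
    have : (p : ℤ) = (a - b * (3 * w + 2)) * (a + b * (3 * w + 2) - b)
        + (3 * w ^ 2 + 3 * w + 1) * (3 * b ^ 2) := by rw [← hab]; ring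
    rw [this]
    exact dvd_add (he.mul_right _) (hn.mul_right _)
  exact hqp ((Nat.prime_dvd_prime_iff_eq hq hp).1 (by exact_mod_cast hqp'))

theorem exists_cube_of_dvd_cubicValue {p : ℕ} [Fact p.Prime] (hp : p ≡ 1 [MOD 3])
    {g : (ZMod p)ˣ} (hg : ∀ x, x ∈ Subgroup.zpowers g) {a b : ℤ}
    (h : ∀ (K : Type) [Field K] (ω : K), ω ^ 2 + ω + 1 = 0 →
      ∀ χ : MulChar (ZMod p) K, χ g = ω → jacobiSum χ χ = a + b * ω)
    {q : ℕ} [Fact q.Prime] (hq3 : q ≠ 3) (hqp : q ≠ p) {w : ℤ}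
    (hw : (q : ℤ) ∣ cubicValue a b w) : ∃ y : ZMod p, y ^ 3 = q := by
  have hq : q.Prime := Fact.out
  have hn := not_dvd_norm_of_dvd_cubicValue Fact.out hq hqp (jacobiSum_coeffs_norm hp hg h) hw
  rw [← ZMod.intCast_zmod_eq_zero_iff_dvd] at hn
  rw [← ZMod.intCast_zmod_eq_zero_iff_dvd, cubicValue] at hw
  push_cast at hn hw
  have h3 : (3 : ZMod q) ≠ 0 := by
    have : ((3 : ℕ) : ZMod q) ≠ 0 := by
      rw [Ne, ZMod.natCast_eq_zero_iff]
      exact fun hd => hq3 ((Nat.prime_dvd_prime_iff_eq hq Nat.prime_three).1 hd)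
    exact_mod_cast this
  set A : ZMod q := 9 * w * (w + 1) ^ 2 + 1 with hA
  set B : ZMod q := 9 * w * (w + 1) + 2 with hB
  -- `3A` and `3B` are the coordinates of `(u + ω)³`. By this norm they do not both vanish, so the
  -- zero determinant gives a scalar `r`.
  have hAB : A ^ 2 - A * B + B ^ 2 = 3 * (3 * (w : ZMod q) ^ 2 + 3 * w + 1) ^ 3 := by
    rw [hA, hB]; ring
  obtain ⟨r, hra, hrb⟩ : ∃ r : ZMod q, (a : ZMod q) = r * (3 * A) ∧ (b : ZMod q) = r * (3 * B) := by
    by_cases hA0 : A = 0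
    · have hB0 : B ≠ 0 := by
        intro hB0
        rw [hA0, hB0] at hAB
        exact mul_ne_zero h3 (pow_ne_zero 3 hn) (by rw [← hAB]; ring)
      refine ⟨b / (3 * B), ?_, by field_simp⟩
      rw [hA0] at hw ⊢
      have : (a : ZMod q) * B = 0 := by linear_combination -hw
      rw [(mul_eq_zero.1 this).resolve_right hB0]; ring
    · refine ⟨a / (3 * A), by field_simp, ?_⟩
      field_simp
      linear_combination hw
  refine exists_cube_of_jacobiSum_eq_mul_cube hp hg h hq3 hqp (3 * w + 2) r ?_ ?_
  · rw [hra, hA]; push_cast; ring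
  · rw [hrb, hB]; push_cast; ring

theorem isCubicResidue_of_exists_cube {p q : ℕ} [Fact p.Prime] (hq : q.Prime) (hqp : q ≠ p)
    (h : ∃ y : ZMod p, y ^ 3 = q) : IsCubicResidue p (q : ℤ) := by
  refine ⟨?_, ?_⟩
  · rw [Nat.isCoprime_iff_coprime]
    exact (Nat.coprime_primes hq Fact.out).2 hqp
  · obtain ⟨y, hy⟩ := h
    obtain ⟨x, rfl⟩ := ZMod.intCast_surjective y
    exact ⟨x, (ZMod.intCast_eq_intCast_iff _ _ _).1 (by push_cast; exact hy)⟩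

/-! ### Counting roots modulo prime powers. -/

/-- Two arguments at which `cubicValue` is divisible by a given prime power are related by one of
three homographic congruences. -/
theorem pow_dvd_of_pow_dvd_cubicValue {p q : ℕ} (hp : p.Prime) (hq : q.Prime) (hq3 : q ≠ 3)
    (hqp : q ≠ p) {a b : ℤ} (hab : a ^ 2 - a * b + b ^ 2 = p) {k : ℕ} (hk : k ≠ 0) {v w : ℤ}
    (hv : (q : ℤ) ^ k ∣ cubicValue a b v) (hw : (q : ℤ) ^ k ∣ cubicValue a b w) :
    (q : ℤ) ^ k ∣ w - v ∨ (q : ℤ) ^ k ∣ w * (3 * v + 2) + (v + 1) ∨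
      (q : ℤ) ^ k ∣ w * (3 * v + 1) + (2 * v + 1) := by
  have hqZ : Prime (q : ℤ) := Nat.prime_iff_prime_int.1 hq
  have hn := not_dvd_norm_of_dvd_cubicValue hp hq hqp hab ((dvd_pow_self _ hk).trans hv)
  set D := w - v with hD
  set S := w * (3 * v + 2) + (v + 1) with hS
  set T := w * (3 * v + 1) + (2 * v + 1) with hT
  have hnine : ¬ (q : ℤ) ∣ 9 := by
    intro h9
    have : q ∣ 3 ^ 2 := by exact_mod_cast h9
    exact hq3 ((Nat.prime_dvd_prime_iff_eq hq Nat.prime_three).1 (hq.dvd_of_dvd_pow this))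
  -- Eliminating `b`, and next `a`, leaves the determinant of the two cubes, which splits into three
  -- factors, one for each cube root of unity.
  have ha9 : (q : ℤ) ^ k ∣ a * (9 * (D * (S * T))) := by
    have : a * (9 * (D * (S * T))) = (9 * v * (v + 1) ^ 2 + 1) * cubicValue a b w
        - (9 * w * (w + 1) ^ 2 + 1) * cubicValue a b v := by
      unfold cubicValue; ring
    rw [this]; exact dvd_sub (hw.mul_left _) (hv.mul_left _)
  have hb9 : (q : ℤ) ^ k ∣ b * (9 * (D * (S * T))) := by
    have : b * (9 * (D * (S * T))) = (9 * v * (v + 1) + 2) * cubicValue a b w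
        - (9 * w * (w + 1) + 2) * cubicValue a b v := by
      unfold cubicValue; ring
    rw [this]; exact dvd_sub (hw.mul_left _) (hv.mul_left _)
  have h9 : (q : ℤ) ^ k ∣ 9 * (D * (S * T)) := by
    by_cases hb : (q : ℤ) ∣ b
    · refine hqZ.pow_dvd_of_dvd_mul_left k (fun ha => ?_) ha9
      have : (q : ℤ) ∣ p := by
        have : (p : ℤ) = a * (a - b) + b * b := by rw [← hab]; ring
        rw [this]
        exact dvd_add (ha.mul_right _) (hb.mul_right _)
      exact hqp ((Nat.prime_dvd_prime_iff_eq hq hp).1 (by exact_mod_cast this))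
    · exact hqZ.pow_dvd_of_dvd_mul_left k hb hb9
  have hDST := hqZ.pow_dvd_of_dvd_mul_left k hnine h9
  -- At most one factor is divisible by `q`, so that one absorbs all of `q ^ k`.
  have hDS : (q : ℤ) ∣ D → ¬ (q : ℤ) ∣ S := fun h1 h2 => hn (by
    have : 3 * v ^ 2 + 3 * v + 1 = S - D * (3 * v + 2) := by rw [hS, hD]; ring
    rw [this]; exact dvd_sub h2 (h1.mul_right _))
  have hDT : (q : ℤ) ∣ D → ¬ (q : ℤ) ∣ T := fun h1 h2 => hn (by
    have : 3 * v ^ 2 + 3 * v + 1 = T - D * (3 * v + 1) := by rw [hT, hD]; ring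
    rw [this]; exact dvd_sub h2 (h1.mul_right _))
  have hST : (q : ℤ) ∣ S → ¬ (q : ℤ) ∣ T := fun h1 h2 => hDS (by
    have : D = S - T := by rw [hS, hD, hT]; ring
    rw [this]; exact dvd_sub h1 h2) h1
  by_cases h1 : (q : ℤ) ∣ D
  · left
    rw [mul_comm] at hDST
    rw [mul_assoc] at hDST
    exact hqZ.pow_dvd_of_dvd_mul_left k (hDT h1) (hqZ.pow_dvd_of_dvd_mul_left k (hDS h1) hDST)
  · have hST' := hqZ.pow_dvd_of_dvd_mul_left k h1 hDST
    by_cases h2 : (q : ℤ) ∣ S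
    · exact Or.inr (Or.inl (hqZ.pow_dvd_of_dvd_mul_right k (hST h2) hST'))
    · exact Or.inr (Or.inr (hqZ.pow_dvd_of_dvd_mul_left k h2 hST'))

theorem card_le_of_forall_dvd_sub {N m : ℕ} {s : Finset ℕ} (hs : s ⊆ Finset.range N)
    (h : ∀ x ∈ s, ∀ y ∈ s, (m : ℤ) ∣ (x : ℤ) - y) : s.card ≤ N / m + 1 := by
  rw [← Finset.card_range (N / m + 1)]
  refine Finset.card_le_card_of_injOn (fun x => x / m) (fun x hx => ?_) (fun x hx y hy hxy => ?_)
  · have := Finset.mem_range.1 (hs hx)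
    exact Finset.mem_coe.2 (Finset.mem_range.2 (Nat.lt_succ_of_le (Nat.div_le_div_right this.le)))
  · have hmod : y ≡ x [MOD m] := (Nat.modEq_iff_dvd).2 (h x hx y hy)
    have hdiv : x / m = y / m := hxy
    rw [← Nat.div_add_mod x m, ← Nat.div_add_mod y m, hdiv, show y % m = x % m from hmod]

theorem card_filter_dvd_linear_le {q : ℕ} (hq : Prime (q : ℤ)) {c e : ℤ} {k : ℕ} (hk : k ≠ 0)
    (hce : (q : ℤ) ∣ c → ¬ (q : ℤ) ∣ e) (N : ℕ) :
    ((Finset.range N).filter fun w : ℕ => (q : ℤ) ^ k ∣ w * c + e).card ≤ N / q ^ k + 1 := by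
  refine card_le_of_forall_dvd_sub (Finset.filter_subset _ _) fun x hx y hy => ?_
  have hx' := (Finset.mem_filter.1 hx).2
  have hy' := (Finset.mem_filter.1 hy).2
  have hc : ¬ (q : ℤ) ∣ c := fun hc => hce hc (by
    have : e = (x * c + e) - c * x := by ring
    rw [this]
    exact dvd_sub ((dvd_pow_self _ hk).trans hx') (hc.mul_right _))
  push_cast
  refine hq.pow_dvd_of_dvd_mul_left k hc ?_
  have : c * ((x : ℤ) - y) = (x * c + e) - (y * c + e) := by ring
  rw [this]
  exact dvd_sub hx' hy'

theorem card_filter_pow_dvd_cubicValue_le {p q : ℕ} (hp : p.Prime) (hp3 : p ≠ 3) (hq : q.Prime)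
    (hq3 : q ≠ 3) {a b : ℤ} (hab : a ^ 2 - a * b + b ^ 2 = p) {k : ℕ} (hk : k ≠ 0) (N : ℕ) :
    ((Finset.range N).filter fun w : ℕ => (q : ℤ) ^ k ∣ cubicValue a b w).card ≤
      3 * (N / q ^ k + 1) := by
  have hqZ : Prime (q : ℤ) := Nat.prime_iff_prime_int.1 hq
  by_cases hqp : q = p
  -- For `q = p` only `k = 1` can occur, and the triple root gives a single residue class.
  · subst hqp
    refine (card_le_of_forall_dvd_sub (m := q ^ k) (Finset.filter_subset _ _)
      fun x hx y hy => ?_).trans (by omega)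
    have hx' := (Finset.mem_filter.1 hx).2
    have hy' := (Finset.mem_filter.1 hy).2
    have hk1 : k = 1 := by
      by_contra hk1
      exact not_sq_dvd_cubicValue hq hq3 hab x ((pow_dvd_pow _ (by omega)).trans hx')
    subst hk1
    rw [pow_one] at hx' hy'
    rw [pow_one]
    have h1 := dvd_sub (dvd_linear_of_dvd_cubicValue hq hab hx')
      (dvd_linear_of_dvd_cubicValue hq hab hy')
    have h2 : (q : ℤ) ∣ b * (3 * ((x : ℤ) - y)) := by
      have : b * (3 * ((x : ℤ) - y)) = b * (3 * x + 2) - a - (b * (3 * y + 2) - a) := by ring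
      rwa [this]
    rcases hqZ.dvd_or_dvd ((hqZ.dvd_or_dvd h2).resolve_left
      (not_dvd_right_of_norm_eq_prime hq hab)) with h3 | h3
    · have : q ∣ 3 := by exact_mod_cast h3
      exact absurd ((Nat.prime_dvd_prime_iff_eq hq Nat.prime_three).1 this) hq3
    · exact h3
  · rcases Finset.eq_empty_or_nonempty
      ((Finset.range N).filter fun w : ℕ => (q : ℤ) ^ k ∣ cubicValue a b w) with he | ⟨v, hv⟩
    · rw [he]; simp
    have hv' := (Finset.mem_filter.1 hv).2
    have h1 := card_filter_dvd_linear_le hqZ (c := 1) (e := -v) hk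
      (fun h1 _ => hqZ.not_isUnit (isUnit_of_dvd_one h1)) N
    have h2 := card_filter_dvd_linear_le hqZ (c := 3 * v + 2) (e := v + 1) hk
      (fun h1 h2 => hqZ.not_isUnit (isUnit_of_dvd_one (by
        have : (1 : ℤ) = 3 * (v + 1) - (3 * v + 2) := by ring
        rw [this]; exact dvd_sub (h2.mul_left _) h1))) N
    have h3 := card_filter_dvd_linear_le hqZ (c := 3 * v + 1) (e := 2 * v + 1) hk
      (fun h1 h2 => hqZ.not_isUnit (isUnit_of_dvd_one (by
        have : (1 : ℤ) = 3 * (2 * v + 1) - 2 * (3 * v + 1) := by ring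
        rw [this]; exact dvd_sub (h2.mul_left _) (h1.mul_left _)))) N
    have hsub : ((Finset.range N).filter fun w : ℕ => (q : ℤ) ^ k ∣ cubicValue a b w) ⊆
        ((Finset.range N).filter fun w : ℕ => (q : ℤ) ^ k ∣ w * 1 + -v) ∪
        (((Finset.range N).filter fun w : ℕ => (q : ℤ) ^ k ∣ w * (3 * v + 2) + (v + 1)) ∪
        ((Finset.range N).filter fun w : ℕ => (q : ℤ) ^ k ∣ w * (3 * v + 1) + (2 * v + 1))) := by
      intro w hw
      have hw' := Finset.mem_filter.1 hw
      simp only [Finset.mem_union, Finset.mem_filter, hw'.1, true_and]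
      rw [mul_one, ← sub_eq_add_neg]
      exact pow_dvd_of_pow_dvd_cubicValue hp hq hq3 hqp hab hk hv' hw'.2
    have h4 := Finset.card_le_card hsub
    have h5 := Finset.card_union_le
      ((Finset.range N).filter fun w : ℕ => (q : ℤ) ^ k ∣ w * 1 + -v)
      (((Finset.range N).filter fun w : ℕ => (q : ℤ) ^ k ∣ w * (3 * v + 2) + (v + 1)) ∪
        ((Finset.range N).filter fun w : ℕ => (q : ℤ) ^ k ∣ w * (3 * v + 1) + (2 * v + 1)))
    have h6 := Finset.card_union_le
      ((Finset.range N).filter fun w : ℕ => (q : ℤ) ^ k ∣ w * (3 * v + 2) + (v + 1))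
      ((Finset.range N).filter fun w : ℕ => (q : ℤ) ^ k ∣ w * (3 * v + 1) + (2 * v + 1))
    omega

/-! ### A Mertens-type bound over an arbitrary finite set of primes. -/

theorem sum_factorization_mul_log_of_subset {n : ℕ} {T : Finset ℕ} (h : n.primeFactors ⊆ T) :
    ∑ q ∈ T, (n.factorization q : ℝ) * Real.log q = Real.log n := by
  rw [Real.log_nat_eq_sum_factorization, Finsupp.sum, Nat.support_factorization]
  refine (Finset.sum_subset h fun q _ hq => ?_).symm
  rw [← Nat.support_factorization, Finsupp.notMem_support_iff] at hq
  simp [hq]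

theorem sum_factorization_mul_log_le (n : ℕ) (T : Finset ℕ) :
    ∑ q ∈ T, (n.factorization q : ℝ) * Real.log q ≤ Real.log n := by
  rw [← sum_factorization_mul_log_of_subset (n := n) (T := T ∪ n.primeFactors)
    Finset.subset_union_right]
  exact Finset.sum_le_sum_of_subset_of_nonneg Finset.subset_union_left fun q _ _ =>
    mul_nonneg (Nat.cast_nonneg _) (Real.log_natCast_nonneg q)

theorem natLog_mul_log_le (q : ℕ) {y : ℕ} (hy : y ≠ 0) :
    (Nat.log q y : ℝ) * Real.log q ≤ Real.log y := by
  rcases Nat.eq_zero_or_pos q with rfl | hq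
  · simpa using Real.log_natCast_nonneg y
  rw [← Real.log_pow]
  exact Real.log_le_log (by positivity) (by exact_mod_cast Nat.pow_log_le_self q hy)

theorem le_sub_one_mul_factorization_factorial {q : ℕ} (hq : q.Prime) (y : ℕ) (hy : y ≠ 0) :
    y ≤ (q - 1) * (y.factorial.factorization q + (Nat.log q y + 1)) := by
  have : Fact q.Prime := ⟨hq⟩
  have h := sub_one_mul_padicValNat_factorial (p := q) y
  have hs : (q.digits y).sum ≤ (Nat.log q y + 1) * (q - 1) := by
    rw [← Nat.length_digits q y hq.one_lt hy]
    have := List.sum_le_card_nsmul (q.digits y) (q - 1) fun x hx => by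
      have := Nat.digits_lt_base hq.one_lt hx
      omega
    simpa using this
  rw [mul_add, Nat.factorization_def _ hq, h]
  nlinarith [Nat.sub_add_cancel (Nat.digit_sum_le q y)]

/-- For `q ≤ y` this is Legendre's formula for `y!`; for `q > y` it follows from `log t / t`
decreasing beyond `e`. Summed over `q`, the first term is at most `log y! ≤ y log y`. -/
theorem log_div_sub_one_le {q : ℕ} (hq : q.Prime) {y : ℕ} (hy : 3 ≤ y) :
    Real.log q / ((q : ℝ) - 1) ≤
      (y.factorial.factorization q * Real.log q + 2 * Real.log y) / y := by
  have hq2 : (2 : ℝ) ≤ q := by exact_mod_cast hq.two_le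
  have hy3 : (3 : ℝ) ≤ y := by exact_mod_cast hy
  have hlq : 0 ≤ Real.log q := Real.log_natCast_nonneg q
  have hly : 0 ≤ Real.log y := Real.log_natCast_nonneg y
  rw [div_le_div_iff₀ (by linarith) (by linarith)]
  rcases le_or_gt q y with hqy | hqy
  · have h1 : (y : ℝ) ≤ (q - 1) * (y.factorial.factorization q + (Nat.log q y + 1)) := by
      have := le_sub_one_mul_factorization_factorial hq y (by omega)
      have h2 : (y : ℝ) ≤ ((q - 1 : ℕ) : ℝ) * (y.factorial.factorization q + (Nat.log q y + 1)) := by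
        exact_mod_cast this
      rwa [Nat.cast_sub hq.one_le, Nat.cast_one] at h2
    have h2 := natLog_mul_log_le q (y := y) (by omega)
    have h3 : Real.log q ≤ Real.log y :=
      Real.log_le_log (by linarith) (by exact_mod_cast hqy)
    calc Real.log q * y ≤ Real.log q * ((q - 1) * (y.factorial.factorization q + (Nat.log q y + 1))) :=
          mul_le_mul_of_nonneg_left h1 hlq
      _ = (y.factorial.factorization q * Real.log q + (Nat.log q y * Real.log q + Real.log q))
            * (q - 1) := by ring
      _ ≤ _ := mul_le_mul_of_nonneg_right (by linarith) (by linarith)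
  · have hqy' : (y : ℝ) ≤ q := by exact_mod_cast hqy.le
    have he : Real.exp 1 ≤ y := by linarith [Real.exp_one_lt_d9]
    have h1 := Real.log_div_self_antitoneOn (Set.mem_Ici.2 he) (Set.mem_Ici.2 (he.trans hqy')) hqy'
    simp only at h1
    rw [div_le_div_iff₀ (by linarith) (by linarith)] at h1
    have h2 : 0 ≤ (y.factorial.factorization q : ℝ) * Real.log q := by positivity
    calc Real.log q * y ≤ Real.log y * q := h1
      _ ≤ 2 * Real.log y * (q - 1) := by nlinarith
      _ ≤ _ := mul_le_mul_of_nonneg_right (by linarith) (by linarith)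

theorem sum_log_div_sub_one_le {T : Finset ℕ} (hT : ∀ q ∈ T, q.Prime) {y : ℕ} (hy : 3 ≤ y) :
    ∑ q ∈ T, Real.log q / ((q : ℝ) - 1) ≤ Real.log y + 2 * T.card * Real.log y / y := by
  have hy0 : (0 : ℝ) < y := by exact_mod_cast (by omega : 0 < y)
  have hfac : Real.log (y.factorial : ℕ) ≤ y * Real.log y := by
    rw [← Real.log_pow]
    exact Real.log_le_log (by exact_mod_cast Nat.factorial_pos y)
      (by exact_mod_cast Nat.factorial_le_pow y)
  calc ∑ q ∈ T, Real.log q / ((q : ℝ) - 1)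
      ≤ ∑ q ∈ T, (y.factorial.factorization q * Real.log q + 2 * Real.log y) / y :=
        Finset.sum_le_sum fun q hq => log_div_sub_one_le (hT q hq) hy
    _ = (∑ q ∈ T, (y.factorial.factorization q : ℝ) * Real.log q + T.card * (2 * Real.log y)) / y := by
        rw [← Finset.sum_div, Finset.sum_add_distrib, Finset.sum_const, nsmul_eq_mul]
    _ ≤ (y * Real.log y + T.card * (2 * Real.log y)) / y := by
        gcongr
        exact (sum_factorization_mul_log_le _ _).trans hfac
    _ = _ := by field_simp

theorem sum_log_div_sub_one_le_card {T : Finset ℕ} (hT : ∀ q ∈ T, q.Prime) :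
    ∑ q ∈ T, Real.log q / ((q : ℝ) - 1) ≤ 2 * Real.log (T.card + 2) + 4 := by
  -- A square `y` keeps the error `2|T| log y / y` bounded, at the price of the factor 2 in front of
  -- the logarithm.
  have h := sum_log_div_sub_one_le hT (y := (T.card + 2) ^ 2) (by nlinarith [Nat.zero_le T.card])
  push_cast at h
  rw [Real.log_pow] at h
  have hk : (0 : ℝ) ≤ T.card := Nat.cast_nonneg _
  have hl : Real.log ((T.card : ℝ) + 2) ≤ T.card + 2 := by
    linarith [Real.log_le_sub_one_of_pos (by linarith : (0 : ℝ) < T.card + 2)]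
  have : 2 * (T.card : ℝ) * ((2 : ℕ) * Real.log (T.card + 2)) / (T.card + 2) ^ 2 ≤ 4 := by
    rw [div_le_iff₀ (by positivity)]
    push_cast
    nlinarith
  push_cast at h this
  linarith

/-! ### Upper bound for a sum of logarithms of values. -/

theorem factorization_eq_card_filter_Ico {q n L : ℕ} (hq : q.Prime) (hn : n ≠ 0)
    (hL : n.factorization q < L) :
    n.factorization q = ((Finset.Ico 1 L).filter fun k => q ^ k ∣ n).card := by
  have : (Finset.Ico 1 L).filter (fun k => q ^ k ∣ n) = Finset.Icc 1 (n.factorization q) := by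
    ext k
    simp only [Finset.mem_filter, Finset.mem_Ico, Finset.mem_Icc,
      hq.pow_dvd_iff_le_factorization hn]
    omega
  rw [this, Nat.card_Icc]
  omega

theorem sum_factorization_le {q : ℕ} (hq : q.Prime) {f : ℕ → ℕ} {N X : ℕ}
    (hf : ∀ w < N, f w ≠ 0) (hX : ∀ w < N, f w ≤ X) {c : ℕ}
    (hc : ∀ k ≠ 0, ((Finset.range N).filter fun w => q ^ k ∣ f w).card ≤ c * (N / q ^ k + 1)) :
    ∑ w ∈ Finset.range N, (f w).factorization q ≤ c * (N / (q - 1) + Nat.log q X) := by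
  have h1 : ∀ w ∈ Finset.range N, (f w).factorization q =
      ∑ k ∈ Finset.Ico 1 (Nat.log q X + 1), if q ^ k ∣ f w then 1 else 0 := by
    intro w hw
    rw [Finset.mem_range] at hw
    rw [← Finset.card_filter]
    refine factorization_eq_card_filter_Ico hq (hf w hw) (Nat.lt_succ_of_le ?_)
    exact Nat.le_log_of_pow_le hq.one_lt
      ((Nat.le_of_dvd (Nat.pos_of_ne_zero (hf w hw)) (Nat.ordProj_dvd _ _)).trans (hX w hw))
  rw [Finset.sum_congr rfl h1, Finset.sum_comm]
  calc ∑ k ∈ Finset.Ico 1 (Nat.log q X + 1), ∑ w ∈ Finset.range N, (if q ^ k ∣ f w then 1 else 0)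
      ≤ ∑ k ∈ Finset.Ico 1 (Nat.log q X + 1), c * (N / q ^ k + 1) := by
        refine Finset.sum_le_sum fun k hk => ?_
        rw [← Finset.card_filter]
        exact hc k (by have := (Finset.mem_Ico.1 hk).1; omega)
    _ = c * (∑ k ∈ Finset.Ico 1 (Nat.log q X + 1), N / q ^ k + Nat.log q X) := by
        rw [← Finset.mul_sum, Finset.sum_add_distrib]; simp
    _ ≤ _ := by
        gcongr
        exact Nat.geom_sum_Ico_le hq.two_le N _

theorem sum_log_le_of_card_filter_le {f : ℕ → ℕ} {N X c : ℕ} {T : Finset ℕ}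
    (hT : ∀ q ∈ T, q.Prime) (hf : ∀ w < N, f w ≠ 0) (hX : ∀ w < N, f w ≤ X) (hX0 : X ≠ 0)
    (hfT : ∀ w < N, (f w).primeFactors ⊆ T)
    (hc : ∀ q ∈ T, ∀ k ≠ 0,
      ((Finset.range N).filter fun w => q ^ k ∣ f w).card ≤ c * (N / q ^ k + 1)) :
    ∑ w ∈ Finset.range N, Real.log (f w) ≤
      c * (N * ∑ q ∈ T, Real.log q / ((q : ℝ) - 1) + T.card * Real.log X) := by
  have h1 : ∀ w ∈ Finset.range N, Real.log (f w) =
      ∑ q ∈ T, ((f w).factorization q : ℝ) * Real.log q := fun w hw =>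
    (sum_factorization_mul_log_of_subset (hfT w (Finset.mem_range.1 hw))).symm
  rw [Finset.sum_congr rfl h1, Finset.sum_comm, mul_add, Finset.mul_sum, Finset.mul_sum,
    ← nsmul_eq_mul T.card, ← Finset.sum_const, Finset.mul_sum, ← Finset.sum_add_distrib]
  refine Finset.sum_le_sum fun q hq => ?_
  have hqP := hT q hq
  have hq2 : (2 : ℝ) ≤ q := by exact_mod_cast hqP.two_le
  have hlq : 0 ≤ Real.log q := Real.log_natCast_nonneg q
  rw [← Finset.sum_mul]
  have h2 : (∑ w ∈ Finset.range N, ((f w).factorization q : ℝ)) ≤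
      c * (N / ((q : ℝ) - 1) + Nat.log q X) := by
    have := sum_factorization_le hqP hf hX (hc q hq)
    have h3 : (∑ w ∈ Finset.range N, ((f w).factorization q : ℝ)) ≤
        c * ((N / (q - 1) : ℕ) + Nat.log q X) := by exact_mod_cast this
    refine h3.trans ?_
    gcongr
    refine Nat.cast_div_le.trans ?_
    rw [Nat.cast_sub hqP.one_le, Nat.cast_one]
  calc _ ≤ (c * (N / ((q : ℝ) - 1) + Nat.log q X)) * Real.log q :=
        mul_le_mul_of_nonneg_right h2 hlq
    _ = c * (N * (Real.log q / ((q : ℝ) - 1))) + c * (Nat.log q X * Real.log q) := by ring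
    _ ≤ _ := by
        gcongr
        exact natLog_mul_log_le q hX0

/-! ### Size of the values of the cubic. -/

theorem cubicValue_third_difference (a b w d : ℤ) :
    cubicValue a b (w + 3 * d) - 3 * cubicValue a b (w + 2 * d) + 3 * cubicValue a b (w + d)
      - cubicValue a b w = 54 * b * d ^ 3 := by
  unfold cubicValue; ring

/-- Among the values at `w`, `w + d`, `w + 2d`, `w + 3d` one is at least `d³` in absolute value:
otherwise their third difference would be below `8d³`, whereas it is `54bd³`. -/
theorem le_sum_log_cubicValue {a b : ℤ} (hb : b ≠ 0) {d : ℕ} (hd : d ≠ 0) :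
    3 * d * Real.log d ≤ ∑ w ∈ Finset.range (4 * d), Real.log (cubicValue a b (w : ℕ)).natAbs := by
  set f : ℕ → ℝ := fun w => Real.log (cubicValue a b (w : ℕ)).natAbs with hf
  have hsplit : ∑ w ∈ Finset.range (4 * d), f w =
      ∑ w ∈ Finset.range d, (f w + f (w + d) + f (w + 2 * d) + f (w + 3 * d)) := by
    rw [show 4 * d = d + d + d + d by ring, Finset.sum_range_add, Finset.sum_range_add,
      Finset.sum_range_add]
    simp only [Finset.sum_add_distrib]
    congr 1
    · congr 1
      · congr 1
        exact Finset.sum_congr rfl fun w _ => by rw [add_comm]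
      · exact Finset.sum_congr rfl fun w _ => by rw [add_comm, two_mul]
    · exact Finset.sum_congr rfl fun w _ => by rw [add_comm, show 3 * d = d + d + d by ring]
  have h0 : ∀ w, 0 ≤ f w := fun w => Real.log_natCast_nonneg _
  have hlarge : ∀ w, d ^ 3 ≤ (cubicValue a b (w : ℕ)).natAbs → 3 * Real.log d ≤ f w := by
    intro w hw
    have : (3 : ℝ) * Real.log d = Real.log ((d ^ 3 : ℕ) : ℝ) := by push_cast; rw [Real.log_pow]; simp
    rw [this]
    exact Real.log_le_log (by positivity) (by exact_mod_cast hw)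
  change _ ≤ ∑ w ∈ Finset.range (4 * d), f w
  rw [hsplit]
  have : (3 : ℝ) * d * Real.log d = ∑ w ∈ Finset.range d, 3 * Real.log d := by
    rw [Finset.sum_const, Finset.card_range, nsmul_eq_mul]; ring
  rw [this]
  refine Finset.sum_le_sum fun w _ => ?_
  by_contra! hcon
  have hsmall : ∀ v, f v ≤ f w + f (w + d) + f (w + 2 * d) + f (w + 3 * d) →
      |cubicValue a b (v : ℕ)| < (d : ℤ) ^ 3 := by
    intro v hv
    by_contra! hge
    have := hlarge v (by zify; exact hge)
    linarith
  have e0 := abs_lt.1 (hsmall w (by linarith [h0 (w + d), h0 (w + 2 * d), h0 (w + 3 * d)]))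
  have e1 := abs_lt.1 (hsmall (w + d) (by linarith [h0 w, h0 (w + 2 * d), h0 (w + 3 * d)]))
  have e2 := abs_lt.1 (hsmall (w + 2 * d) (by linarith [h0 w, h0 (w + d), h0 (w + 3 * d)]))
  have e3 := abs_lt.1 (hsmall (w + 3 * d) (by linarith [h0 w, h0 (w + d), h0 (w + 2 * d)]))
  push_cast at e0 e1 e2 e3
  have hdiff := cubicValue_third_difference a b w d
  have hd3 : (0 : ℤ) < (d : ℤ) ^ 3 := by positivity
  rcases lt_or_gt_of_ne hb with hb' | hb'
  · nlinarith
  · nlinarith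

theorem abs_cubicValue_le {p : ℕ} {a b : ℤ} (hab : a ^ 2 - a * b + b ^ 2 = p) {d w : ℕ}
    (hw : w < 4 * d) : |(cubicValue a b (w : ℕ) : ℝ)| ≤ 1500 * Real.sqrt p * d ^ 3 := by
  have hab' : (a : ℝ) ^ 2 - a * b + b ^ 2 = p := by exact_mod_cast hab
  have ha : |(a : ℝ)| ≤ 2 * Real.sqrt p := by
    rw [← Real.sqrt_sq_eq_abs, show (2 : ℝ) = Real.sqrt (2 ^ 2) by simp, ← Real.sqrt_mul (by norm_num)]
    exact Real.sqrt_le_sqrt (by nlinarith [sq_nonneg ((a : ℝ) - 2 * b)])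
  have hb : |(b : ℝ)| ≤ 2 * Real.sqrt p := by
    rw [← Real.sqrt_sq_eq_abs, show (2 : ℝ) = Real.sqrt (2 ^ 2) by simp, ← Real.sqrt_mul (by norm_num)]
    exact Real.sqrt_le_sqrt (by nlinarith [sq_nonneg ((b : ℝ) - 2 * a)])
  have hd : (1 : ℝ) ≤ d := by exact_mod_cast (by omega : 1 ≤ d)
  have hw1 : (w : ℝ) + 1 ≤ 4 * d := by exact_mod_cast hw
  have hw0 : (0 : ℝ) ≤ w := Nat.cast_nonneg w
  have hA0 : (0 : ℝ) ≤ 9 * w * (w + 1) ^ 2 + 1 := by positivity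
  have hB0 : (0 : ℝ) ≤ 9 * w * (w + 1) + 2 := by positivity
  have h2 : (d : ℝ) ^ 2 ≤ d ^ 3 := pow_le_pow_right₀ hd (by norm_num)
  have h1 : (1 : ℝ) ≤ d ^ 3 := one_le_pow₀ hd
  have hw4 : (w : ℝ) ≤ 4 * d := by linarith
  have hA : (9 : ℝ) * w * (w + 1) ^ 2 + 1 ≤ 577 * d ^ 3 := by
    have : (9 : ℝ) * w * (w + 1) ^ 2 ≤ 9 * (4 * d) * (4 * d) ^ 2 := by gcongr
    nlinarith
  have hB : (9 : ℝ) * w * (w + 1) + 2 ≤ 146 * d ^ 3 := by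
    have : (9 : ℝ) * w * (w + 1) ≤ 9 * (4 * d) * (4 * d) := by gcongr
    nlinarith
  unfold cubicValue
  push_cast
  calc |(b : ℝ) * (9 * w * (w + 1) ^ 2 + 1) - a * (9 * w * (w + 1) + 2)|
      ≤ |(b : ℝ) * (9 * w * (w + 1) ^ 2 + 1)| + |(a : ℝ) * (9 * w * (w + 1) + 2)| := abs_sub _ _
    _ = |(b : ℝ)| * (9 * w * (w + 1) ^ 2 + 1) + |(a : ℝ)| * (9 * w * (w + 1) + 2) := by
        rw [abs_mul, abs_mul, abs_of_nonneg hA0, abs_of_nonneg hB0]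
    _ ≤ 2 * Real.sqrt p * (577 * d ^ 3) + 2 * Real.sqrt p * (146 * d ^ 3) := by gcongr
    _ ≤ _ := by nlinarith [mul_nonneg (Real.sqrt_nonneg p) (by positivity : (0 : ℝ) ≤ (d : ℝ) ^ 3)]

/-! ### Comparison of the bounds and conclusion. -/

/-- If the prime divisors of the first `4d` values of `cubicValue` all lie in `T`, then `T` is
large. -/
theorem log_le_of_primeFactors_subset {p : ℕ} (hp : p.Prime) (hp3 : p ≠ 3) {a b : ℤ}
    (hab : a ^ 2 - a * b + b ^ 2 = p) {d X : ℕ} (hd : d ≠ 0) (hX0 : X ≠ 0)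
    (hX : ∀ w < 4 * d, (cubicValue a b (w : ℕ)).natAbs ≤ X) {T : Finset ℕ}
    (hT : ∀ q ∈ T, q.Prime ∧ q ≠ 3)
    (hfT : ∀ w < 4 * d, (cubicValue a b (w : ℕ)).natAbs.primeFactors ⊆ T) :
    Real.log d ≤ 8 * Real.log (T.card + 2) + 16 + T.card * Real.log X / d := by
  have hd0 : (0 : ℝ) < d := by exact_mod_cast Nat.pos_of_ne_zero hd
  have hb : b ≠ 0 := fun hb => not_dvd_right_of_norm_eq_prime hp hab (hb ▸ dvd_zero _)
  have h1 := le_sum_log_cubicValue (a := a) hb hd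
  have h2 := sum_log_le_of_card_filter_le (f := fun w => (cubicValue a b (w : ℕ)).natAbs)
    (N := 4 * d) (X := X) (c := 3) (T := T) (fun q hq => (hT q hq).1)
    (fun w _ => Int.natAbs_ne_zero.2 (cubicValue_ne_zero hp hp3 hab w)) hX hX0 hfT (by
      intro q hq k hk
      have := card_filter_pow_dvd_cubicValue_le hp hp3 (hT q hq).1 (hT q hq).2 hab hk (4 * d)
      refine le_trans (Finset.card_le_card fun w hw => ?_) this
      rw [Finset.mem_filter] at hw ⊢
      exact ⟨hw.1, by have := Int.natCast_dvd.2 hw.2; exact_mod_cast this⟩)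
  have h3 := sum_log_div_sub_one_le_card fun q hq => (hT q hq).1
  have h4 := h1.trans h2
  push_cast at h4
  have h5 : 3 * (4 * (d : ℝ) * ∑ q ∈ T, Real.log q / ((q : ℝ) - 1) + T.card * Real.log X) ≤
      3 * (4 * (d : ℝ) * (2 * Real.log (T.card + 2) + 4) + T.card * Real.log X) := by gcongr
  have h6 := h4.trans h5
  have h7 : Real.log d * d ≤
      (8 * Real.log (T.card + 2) + 16) * d + T.card * Real.log X := by linarith
  rw [← sub_le_iff_le_add', le_div_iff₀ hd0]
  linarith

/-- With `d` of order `P ^ 10` and `k ≤ 2P`, the left side of `h` is about `10 log P` against `8 log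
P`, and the last term is bounded; the surplus is `2 log P`. -/
theorem two_mul_log_le_of_card_le {P C : ℝ} (hP1 : 200 ≤ P) (hC : 0 ≤ C)
    {d k : ℕ} {X : ℕ} (hd : P ^ 10 / 200 ≤ d) (hk : (k : ℝ) ≤ 2 * P)
    (hX : Real.log X ≤ C * Real.log P)
    (h : Real.log d ≤ 8 * Real.log (k + 2) + 16 + k * Real.log X / d) :
    2 * Real.log P ≤ Real.log 200 + 8 * Real.log 4 + 16 + 400 * C := by
  have hP0 : 0 < P := by linarith
  have hd0 : (0 : ℝ) < d := lt_of_lt_of_le (by positivity) hd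
  have h1 : 10 * Real.log P - Real.log 200 ≤ Real.log d := by
    have := Real.log_le_log (by positivity) hd
    rw [Real.log_div (by positivity) (by norm_num), Real.log_pow] at this
    exact_mod_cast this
  have h2 : Real.log (k + 2) ≤ Real.log 4 + Real.log P := by
    rw [← Real.log_mul (by norm_num) hP0.ne']
    exact Real.log_le_log (by positivity) (by linarith)
  have h3 : k * Real.log X / d ≤ 400 * C := by
    rw [div_le_iff₀ hd0]
    have hlP : Real.log P ≤ P := by linarith [Real.log_le_sub_one_of_pos hP0]
    have hP10 : P ^ 2 ≤ P ^ 10 := pow_le_pow_right₀ (by linarith) (by norm_num)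
    calc k * Real.log X ≤ 2 * P * (C * P) := by
          refine mul_le_mul hk (hX.trans (by gcongr)) (Real.log_natCast_nonneg X) (by positivity)
      _ = 2 * C * P ^ 2 := by ring
      _ ≤ 2 * C * (200 * d) := by gcongr; linarith
      _ = 400 * C * d := by ring
  linarith

theorem theorem1 (ε : ℝ) (hε : 0 < ε) :
    ∃ p₀ : ℝ, ∀ p : ℕ, p.Prime → p ≡ 1 [MOD 3] → p₀ < (p : ℝ) →
      (p : ℝ) ^ (ε / 30) <
        (({q : ℕ | q.Prime ∧ (q : ℝ) < (p : ℝ) ^ (1 / 2 + ε) ∧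
            IsCubicResidue p (q : ℤ)}.ncard : ℕ) : ℝ) := by
  -- Chosen so that `p ^ (1 / 2 + ε) = P ^ C` for `P = p ^ (ε / 30)`.
  set C : ℝ := (1 / 2 + ε) * (30 / ε) with hC
  have hC0 : 0 ≤ C := by positivity
  set M : ℝ := Real.log 200 + 8 * Real.log 4 + 16 + 400 * C with hM
  have hl200 : 0 ≤ Real.log 200 := Real.log_nonneg (by norm_num)
  have hl4 : 0 ≤ Real.log 4 := Real.log_nonneg (by norm_num)
  -- This threshold is `log P > M`, contrary to the final bound `2 log P ≤ M`.
  refine ⟨Real.exp (30 / ε * M), fun p hp hp1 hpM => ?_⟩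
  have : Fact p.Prime := ⟨hp⟩
  have hp0 : (0 : ℝ) < p := by exact_mod_cast hp.pos
  have hp3 : p ≠ 3 := by rintro rfl; exact absurd hp1 (by decide)
  set P : ℝ := (p : ℝ) ^ (ε / 30) with hP
  have hP0 : 0 < P := Real.rpow_pos_of_pos hp0 _
  have hlogP : Real.log P = ε / 30 * Real.log p := Real.log_rpow hp0 _
  have hMP : M < Real.log P := by
    have := (Real.lt_log_iff_exp_lt hp0).2 hpM
    rw [hlogP]
    calc M = ε / 30 * (30 / ε * M) := by field_simp
      _ < _ := by gcongr
  have hP200 : 200 ≤ P := by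
    rw [← Real.log_le_log_iff (by norm_num) hP0]
    linarith
  have hP10 : P ^ 10 = (p : ℝ) ^ (ε / 3) := by
    rw [hP, ← Real.rpow_natCast, ← Real.rpow_mul hp0.le]
    congr 1; push_cast; ring
  have hP30 : (P ^ 10) ^ 3 = (p : ℝ) ^ ε := by
    rw [hP10, ← Real.rpow_natCast, ← Real.rpow_mul hp0.le]
    congr 1; push_cast; ring
  by_contra! hcard
  set S : Set ℕ := {q : ℕ | q.Prime ∧ (q : ℝ) < (p : ℝ) ^ (1 / 2 + ε) ∧
    IsCubicResidue p (q : ℤ)} with hS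
  have hSfin : S.Finite := by
    refine (Set.finite_Iic ⌊(p : ℝ) ^ (1 / 2 + ε)⌋₊).subset fun q hq => ?_
    exact Nat.le_floor hq.2.1.le
  -- The divisor 100 beats the constant 1500 of `abs_cubicValue_le`, as `1500 / 100³ < 1`.
  set d : ℕ := ⌊P ^ 10 / 100⌋₊ with hd
  have hP10big : 200 ≤ P ^ 10 := hP200.trans (le_self_pow₀ (by linarith) (by norm_num))
  have hdle : (d : ℝ) ≤ P ^ 10 / 100 := Nat.floor_le (by positivity)
  have hdge : P ^ 10 / 200 ≤ d := by
    have := Nat.lt_floor_add_one (P ^ 10 / 100)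
    rw [← hd] at this
    linarith
  have hd0 : d ≠ 0 := by
    rintro h0
    rw [h0] at hdge
    norm_num at hdge
    linarith
  obtain ⟨g, hg⟩ := IsCyclic.exists_generator (α := (ZMod p)ˣ)
  obtain ⟨a, b, hJ⟩ := exists_jacobiSum_coeffs p g hg
  have hab := jacobiSum_coeffs_norm hp1 hg hJ
  have hsize : ∀ w < 4 * d, ((cubicValue a b (w : ℕ)).natAbs : ℝ) < (p : ℝ) ^ (1 / 2 + ε) := by
    intro w hw
    have h1 := abs_cubicValue_le hab hw
    rw [Nat.cast_natAbs, Int.cast_abs]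
    refine h1.trans_lt ?_
    rw [Real.rpow_add hp0, ← Real.sqrt_eq_rpow, mul_comm (1500 : ℝ), mul_assoc, ← hP30]
    have hsq : 0 < Real.sqrt p := Real.sqrt_pos.2 hp0
    gcongr
    calc 1500 * (d : ℝ) ^ 3 ≤ 1500 * (P ^ 10 / 100) ^ 3 := by gcongr
      _ = 3 / 2000 * (P ^ 10) ^ 3 := by ring
      _ < (P ^ 10) ^ 3 := by
        have : 0 < (P ^ 10) ^ 3 := by positivity
        linarith
  set T : Finset ℕ := (Finset.range (4 * d)).biUnion
    fun w => (cubicValue a b (w : ℕ)).natAbs.primeFactors with hT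
  set X : ℕ := ⌊(p : ℝ) ^ (1 / 2 + ε)⌋₊ with hX
  have hX1 : 1 ≤ X := Nat.le_floor (by
    rw [Nat.cast_one]
    exact Real.one_le_rpow (by exact_mod_cast hp.one_le) (by positivity))
  have hlogX : Real.log X ≤ C * Real.log P := by
    have h1 : (X : ℝ) ≤ (p : ℝ) ^ (1 / 2 + ε) := Nat.floor_le (by positivity)
    have h2 := Real.log_le_log (by exact_mod_cast hX1) h1
    rw [Real.log_rpow hp0] at h2
    refine h2.trans (le_of_eq ?_)
    rw [hlogP, hC]; field_simp
  have hTP : ∀ q ∈ T, q.Prime ∧ q ≠ 3 := by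
    intro q hq
    obtain ⟨w, -, hqw⟩ := Finset.mem_biUnion.1 hq
    have hdvd := Int.natCast_dvd.2 (Nat.dvd_of_mem_primeFactors hqw)
    refine ⟨Nat.prime_of_mem_primeFactors hqw, ?_⟩
    rintro rfl
    exact not_three_dvd_cubicValue hp1 hab w hdvd
  -- The prime `p` may divide a value without being a residue; it costs only 1 in the count.
  have hTS : T ⊆ insert p hSfin.toFinset := by
    intro q hq
    obtain ⟨w, hw, hqw⟩ := Finset.mem_biUnion.1 hq
    rw [Finset.mem_range] at hw
    obtain ⟨hqP, hq3⟩ := hTP q hq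
    rw [Finset.mem_insert]
    by_cases hqp : q = p
    · exact Or.inl hqp
    right
    rw [Set.Finite.mem_toFinset]
    have : Fact q.Prime := ⟨hqP⟩
    have hdvd := Int.natCast_dvd.2 (Nat.dvd_of_mem_primeFactors hqw)
    refine ⟨hqP, lt_of_le_of_lt ?_ (hsize w hw),
      isCubicResidue_of_exists_cube hqP hqp (exists_cube_of_dvd_cubicValue hp1 hg hJ hq3 hqp hdvd)⟩
    exact_mod_cast Nat.le_of_mem_primeFactors hqw
  have hTcard : (T.card : ℝ) ≤ 2 * P := by
    have h1 := (Finset.card_le_card hTS).trans (Finset.card_insert_le _ _)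
    rw [← Set.ncard_eq_toFinset_card S hSfin] at h1
    have h2 : (T.card : ℝ) ≤ (S.ncard : ℝ) + 1 := by exact_mod_cast h1
    linarith
  have hlog := log_le_of_primeFactors_subset hp hp3 hab hd0 (by omega : X ≠ 0)
    (fun w hw => Nat.le_floor (hsize w hw).le) hTP
    fun w hw => Finset.subset_biUnion_of_mem
      (fun w : ℕ => (cubicValue a b (w : ℕ)).natAbs.primeFactors) (Finset.mem_range.2 hw)
  have := two_mul_log_le_of_card_le hP200 hC0 hdge hTcard hlogX hlog
  have hM0 : 0 < M := by rw [hM]; linarith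
  linarith
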